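/- Let $\mathscr S$ be the set of rooted plane labeled trees $\theta=(\tau,\ell)$ (locally finite, integer labels varying by at most $1$ along each edge, root $\varnothing$ with $\ell(\varnothing)=0$) which have exactly one spine, i.e. one infinite sequence $\mathrm S(0)=\varnothing,\mathrm S(1),\mathrm S(2),\dots$ of vertices in which each is the parent of the next, and such that $\inf_i\ell(\mathrm S(i))=-\infty$. Let $(c_i)_{i\in\mathbb Z}$ be the corners of $\tau$ in clockwise contour order: $(c_i)_{i\ge 0}$ are the corners visited by the clockwise contour of the left side of the tree, started from the root corner $c_0$, and $(c_{-i})_{i\ge 0}$ those visited by the counterclockwise contour of the right side. The successor of $c_i$ is the first corner $c_j$, $j>i$, with $\ell(c_j)=\ell(c_i)-1$. Let $Q$ be the infinite quadrangulation obtained by the Schaeffer correspondence: its vertex set is the vertex set of $\tau$, and its edges are the arcs drawn from each corner to its successor. Let $\hat Q$ be the graph obtained by adding to $Q$ the edges of $\tau$. For $l\in\mathbb Z$ let $H_l=\{v:\ell(v)\le l\}$. For $l<0$ let $F_l$ be the set of vertices of the connected component containing $\varnothing$ of the subgraph of $\hat Q$ induced by the complement of $H_l$, and let $\partial F_l$ be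 the set of vertices of $H_l$ that are joined to $F_l$ by an edge of $\hat Q$. Let $[[\varnothing,v]]$ be the set of vertices on the geodesic path from $\varnothing$ to $v$ in $\tau$. Then for every $\theta\in\mathscr S$, every integer $r>0$ and every vertex $v$: 1. $v\in F_{-r}$ if and only if $\ell(v')>-r$ for every $v'\in[[\varnothing,v]]$; 2. $v\in\partial F_{-r}$ if and only if $\ell(v)=-r$ and $\ell(v')>-r$ for every $v'\in[[\varnothing,v]]\setminus\{v\}$. In particular, let $\theta=(T_\infty,\ell)$ be the uniform infinite labeled tree: almost surely $\theta\in\mathscr S$, the labels along the spine form a random walk with independent uniform steps in $\{-1,0,1\}$, and, conditionally on these labels $(x_n)_{n\ge0}$, the labeled trees grafted to the left and to the right of the spine vertices are independent, those at $\mathrm S(n)$ having law $\rho_{x_n}$, where $\rho_x(t)=\tfrac12\,12^{-|t|}$ for every finite labeled tree $t$ with $|t|$ edges and root label $x$. Then, for the associated random quadrangulation $Q_\infty$ (the uniform infinite planar quadrangulation), almost surely 1 and 2 hold for all integers $r>0$ and all vertices $v$. -/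

import Mathlib

open MeasureTheory

/-- A rooted planar tree, as a set of finite words in `ℕ`. A word is stored with its *last* letter
at the head of the list: the root is `[]`, the children of `u` are `0 :: u, 1 :: u, …` from left to
right, and the parent of `j :: u` is `u`. Every vertex has finitely many children. -/
structure PlaneTree where
  carrier : Set (List ℕ)
  nil_mem : [] ∈ carrier
  parent_mem : ∀ (j : ℕ) (u : List ℕ), j :: u ∈ carrier → u ∈ carrier
  exists_children : ∀ u ∈ carrier, ∃ k : ℕ, ∀ j : ℕ, j :: u ∈ carrier ↔ j < k

namespace PlaneTree

/-- The vertices of the tree. -/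
abbrev Vertex (τ : PlaneTree) : Type := {u : List ℕ // u ∈ τ.carrier}

/-- The root vertex `∅`. -/
def root (τ : PlaneTree) : τ.Vertex := ⟨[], τ.nil_mem⟩

/-- The number of children of a vertex. -/
noncomputable def numChildren (τ : PlaneTree) (u : τ.Vertex) : ℕ :=
  (τ.exists_children u.1 u.2).choose

theorem cons_mem_iff (τ : PlaneTree) (u : τ.Vertex) (j : ℕ) :
    j :: u.1 ∈ τ.carrier ↔ j < τ.numChildren u :=
  (τ.exists_children u.1 u.2).choose_spec j

/-- `u` is the parent of `v`. -/
def IsParent (τ : PlaneTree) (u v : τ.Vertex) : Prop := ∃ j : ℕ, v.1 = j :: u.1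

/-- The tree seen as a graph: edges link a vertex to its parent. -/
def graph (τ : PlaneTree) : SimpleGraph τ.Vertex where
  Adj u v := τ.IsParent u v ∨ τ.IsParent v u
  symm := ⟨fun _ _ h => h.symm⟩
  loopless := ⟨fun u h => by
    rcases h with ⟨j, h⟩ | ⟨j, h⟩ <;> simpa using congrArg List.length h⟩

/-- `⟦a, b⟧`: the set of vertices along the geodesic path from `a` to `b` in the tree. -/
def treePath (τ : PlaneTree) (a b : τ.Vertex) : Set τ.Vertex :=
  {w | ∃ p : τ.graph.Walk a b, p.length = τ.graph.dist a b ∧ w ∈ p.support}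

/-- A spine: an infinite sequence of vertices started at the root, each the parent of the next. -/
def IsSpine (τ : PlaneTree) (s : ℕ → τ.Vertex) : Prop :=
  s 0 = τ.root ∧ ∀ i : ℕ, τ.IsParent (s i) (s (i + 1))

/-- A corner, given by a vertex and a position among its children: `idx = j` is the sector that
follows the `j` leftmost children of the vertex and precedes the others. (At the root, the first
sector `idx = 0` and the last one `idx = numChildren` are the two halves of one and the same corner;
`contour` below lists it once.) -/
structure Corner (τ : PlaneTree) where
  vertex : τ.Vertex
  idx : ℕ
  idx_le : idx ≤ τ.numChildren vertex

/-- One step of the clockwise contour process: move to the next child if there is one left,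
otherwise return to the parent. -/
noncomputable def Corner.next {τ : PlaneTree} (c : τ.Corner) : τ.Corner :=
  if h : c.idx < τ.numChildren c.vertex then
    ⟨⟨c.idx :: c.vertex.1, (τ.cons_mem_iff c.vertex c.idx).2 h⟩, 0, Nat.zero_le _⟩
  else
    match c.vertex with
    | ⟨[], _⟩ => c
    | ⟨j :: u, hu⟩ =>
      ⟨⟨u, τ.parent_mem j u hu⟩, j + 1, (τ.cons_mem_iff ⟨u, τ.parent_mem j u hu⟩ j).1 hu⟩

/-- One step of the counterclockwise contour process, the reverse of `Corner.next`. -/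
noncomputable def Corner.prev {τ : PlaneTree} (c : τ.Corner) : τ.Corner :=
  match c with
  | ⟨u, j + 1, h⟩ => ⟨⟨j :: u.1, (τ.cons_mem_iff u j).2 h⟩, _, le_refl _⟩
  | ⟨⟨[], hu⟩, 0, h⟩ => ⟨⟨[], hu⟩, 0, h⟩
  | ⟨⟨j :: u, hu⟩, 0, _⟩ =>
    ⟨⟨u, τ.parent_mem j u hu⟩, j, ((τ.cons_mem_iff ⟨u, τ.parent_mem j u hu⟩ j).1 hu).le⟩

/-- The sequence `(c_i)`, `i ∈ ℤ`, of corners of an infinite tree with one spine: for `i ≥ 0` the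
clockwise contour (left side of the tree) from the root corner, for `i < 0` the counterclockwise
contour (right side) from the same corner. -/
noncomputable def contour (τ : PlaneTree) : ℤ → τ.Corner
  | Int.ofNat n => Corner.next^[n] ⟨τ.root, 0, Nat.zero_le _⟩
  | Int.negSucc n => Corner.prev^[n + 1] ⟨τ.root, τ.numChildren τ.root, le_refl _⟩

end PlaneTree

/-- A rooted labeled tree: integer labels that vary by at most `1` along every edge. -/
structure LabeledTree extends PlaneTree where
  label : toPlaneTree.Vertex → ℤ
  abs_label_sub_le : ∀ u v : toPlaneTree.Vertex,
    toPlaneTree.IsParent u v → |label u - label v| ≤ 1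

namespace LabeledTree

/-- The class `𝒮` of labeled trees with root label `0` that have exactly one spine, along which the
labels have infimum `-∞`. -/
structure InS (θ : LabeledTree) : Prop where
  label_root : θ.label θ.root = 0
  existsUnique_spine : ∃! s : ℕ → θ.Vertex, θ.IsSpine s
  not_bddBelow : ∀ s : ℕ → θ.Vertex, θ.IsSpine s → ¬ BddBelow (Set.range fun i => θ.label (s i))

/-- The label of the `i`-th corner. -/
noncomputable def cornerLabel (θ : LabeledTree) (i : ℤ) : ℤ := θ.label (θ.contour i).vertex

/-- The corner `c_j` is the successor of `c_i`: the first corner after `c_i` whose label is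
`ℓ(c_i) - 1`. -/
def IsSuccessor (θ : LabeledTree) (i j : ℤ) : Prop :=
  IsLeast {k : ℤ | i < k ∧ θ.cornerLabel k = θ.cornerLabel i - 1} j

/-- The graph of the quadrangulation `Q` that the Schaeffer correspondence associates with `θ`: its
vertices are those of the tree and its edges are the arcs drawn from every corner to its successor
(only adjacency is recorded: multiple arcs are not told apart, and the root edge, which
joins `c_0` to its successor, carries no orientation). -/
def quadGraph (θ : LabeledTree) : SimpleGraph θ.Vertex :=
  SimpleGraph.fromRel fun u v =>
    ∃ i j : ℤ, θ.IsSuccessor i j ∧ (θ.contour i).vertex = u ∧ (θ.contour j).vertex = v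

/-- The augmented graph `Q̂`: the edges of the tree are added to `Q`. -/
def augGraph (θ : LabeledTree) : SimpleGraph θ.Vertex := θ.quadGraph ⊔ θ.graph

/-- The horoball `H_l`. -/
def horoball (θ : LabeledTree) (l : ℤ) : Set θ.Vertex := {v | θ.label v ≤ l}

/-- `F_l`: the vertices of the connected component containing `∅` of the subgraph of `Q̂` induced by
the complement of `H_l`. -/
def rootComponent (θ : LabeledTree) (l : ℤ) : Set θ.Vertex :=
  {v | ∃ (h₀ : θ.root ∈ (θ.horoball l)ᶜ) (hv : v ∈ (θ.horoball l)ᶜ),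
    (θ.augGraph.induce (θ.horoball l)ᶜ).Reachable ⟨θ.root, h₀⟩ ⟨v, hv⟩}

/-- `∂F_l`: the vertices of `H_l` that are joined to `F_l` by an edge of `Q̂`. -/
def rootComponentBoundary (θ : LabeledTree) (l : ℤ) : Set θ.Vertex :=
  {v | v ∈ θ.horoball l ∧ ∃ u ∈ θ.rootComponent l, θ.augGraph.Adj u v}

/-- `θ` and `t` have the same vertices up to height `h`, with the same labels. -/
def SameBall (h : ℕ) (θ t : LabeledTree) : Prop :=
  ∀ u : List ℕ, u.length ≤ h → (u ∈ θ.carrier ↔ u ∈ t.carrier) ∧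
    ∀ (hu : u ∈ θ.carrier) (hu' : u ∈ t.carrier), θ.label ⟨u, hu⟩ = t.label ⟨u, hu'⟩

/-- The Borel `σ`-algebra of the local distance on labeled trees: it is generated by the balls, that
is by the sets of all trees that agree with a given one up to a given height. -/
instance : MeasurableSpace LabeledTree :=
  MeasurableSpace.generateFrom {A | ∃ (h : ℕ) (t : LabeledTree), A = {θ | SameBall h θ t}}

/-- `t` is the labeled tree formed by the vertex `w` of `θ` together with the children of `w` of
index in `[a, b)` and all their descendants. -/
structure IsBranch (θ : LabeledTree) (w : θ.Vertex) (a b : ℕ) (t : LabeledTree) : Prop where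
  mem_iff : ∀ (u : List ℕ) (j : ℕ),
    u ++ [j] ∈ t.carrier ↔ a + j < b ∧ u ++ (a + j) :: w.1 ∈ θ.carrier
  label_root : t.label t.root = θ.label w
  label_eq : ∀ (u : List ℕ) (j : ℕ) (h : u ++ [j] ∈ t.carrier)
    (h' : u ++ (a + j) :: w.1 ∈ θ.carrier),
    t.label ⟨u ++ [j], h⟩ = θ.label ⟨u ++ (a + j) :: w.1, h'⟩

/-- The subtrees of `θ` grafted to the left and to the right of the `i`-th vertex of the spine `s`
are `L` and `R`. -/
def HasSideTrees (θ : LabeledTree) (s : ℕ → θ.Vertex) (i : ℕ) (L R : LabeledTree) : Prop :=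
  ∃ a : ℕ, (s (i + 1)).1 = a :: (s i).1 ∧
    θ.IsBranch (s i) 0 a L ∧ θ.IsBranch (s i) (a + 1) (θ.numChildren (s i)) R

/-- The probability `(1/2) 12^{-|t|}`, `|t|` being the number of edges, of the finite tree `t` under
the law `ρ_l` (with `l` its root label) of the geometric Galton–Watson tree with uniform label
increments in `{-1, 0, 1}`. -/
noncomputable def gwWeight (t : LabeledTree) : ENNReal :=
  2⁻¹ * (12⁻¹) ^ (t.carrier.ncard - 1)

/-- The random labeled tree `θ` has the law `μ` of the uniform infinite labeled tree `(T_∞, ℓ)`: it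
lies almost surely in `𝒮`; the labels along the spine form a random walk with independent uniform
steps in `{-1, 0, 1}`; and given these labels `(x_n)`, the trees grafted to the left and to the right
of the vertices of the spine are all independent, those at the `n`-th vertex having law
`ρ_{x_n}`. -/
structure IsUniformInfiniteTree {Ω : Type*} [MeasurableSpace Ω] (P : Measure Ω)
    (θ : Ω → LabeledTree) : Prop where
  measurable : Measurable θ
  inS : ∀ᵐ ω ∂P, (θ ω).InS
  spine_law : ∀ (n : ℕ) (x : ℕ → ℤ), x 0 = 0 → (∀ i < n, |x (i + 1) - x i| ≤ 1) →
    P {ω | ∃ s, (θ ω).IsSpine s ∧ ∀ i ≤ n, (θ ω).label (s i) = x i} = (3⁻¹) ^ n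
  side_law : ∀ (n : ℕ) (x : ℕ → ℤ) (L R : ℕ → LabeledTree),
    (∀ i ≤ n, (L i).carrier.Finite ∧ (R i).carrier.Finite ∧
      (L i).label (L i).root = x i ∧ (R i).label (R i).root = x i) →
    P {ω | ∃ s, (θ ω).IsSpine s ∧ ∀ i ≤ n, (θ ω).HasSideTrees s i (L i) (R i)} =
      P {ω | ∃ s, (θ ω).IsSpine s ∧ ∀ i ≤ n, (θ ω).label (s i) = x i} *
        ∏ i ∈ Finset.range (n + 1), (L i).gwWeight * (R i).gwWeight

end LabeledTree

namespace PlaneTree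

/-! ### Geodesics from the root -/

variable {τ : PlaneTree}

/-! The contour moves along tree edges, so it cannot enter or leave the descendants of `w` without
visiting `w` (`exists_contour_vertex_eq`). Between a corner and its successor, labels stay at least
that of the source. Hence an ancestor of only one end of an arc is the target or is labeled at least
as high as the source (`IsSuccessor.eq_or_le_label`). So having all ancestors above `l` passes along
every edge of `Q̂` to any end above `l`, hence to the whole component of the root. Conversely, the
ancestral line is itself a path of `Q̂`. For the boundary, labels drop by at most one along an edge,
and a boundary vertex is reached from its parent. -/

theorem length_le_of_adj {x y : τ.Vertex} (h : τ.graph.Adj x y) :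
    y.1.length ≤ x.1.length + 1 := by
  rcases h with ⟨j, h⟩ | ⟨j, h⟩
  · rw [h, List.length_cons]
  · rw [h, List.length_cons]
    omega

theorem length_le_of_walk {x y : τ.Vertex} (p : τ.graph.Walk x y) :
    y.1.length ≤ x.1.length + p.length := by
  induction p with
  | nil => simp
  | cons h p ih =>
    have := length_le_of_adj h
    rw [SimpleGraph.Walk.length_cons]
    omega

theorem exists_walk_length_eq (u : List ℕ) (hu : u ∈ τ.carrier) :
    ∃ p : τ.graph.Walk τ.root ⟨u, hu⟩, p.length = u.length := by
  induction u with
  | nil => exact ⟨SimpleGraph.Walk.nil, rfl⟩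
  | cons j u ih =>
    obtain ⟨p, hp⟩ := ih (τ.parent_mem j u hu)
    have hadj : τ.graph.Adj ⟨u, τ.parent_mem j u hu⟩ ⟨j :: u, hu⟩ := Or.inl ⟨j, rfl⟩
    exact ⟨p.concat hadj, by rw [SimpleGraph.Walk.length_concat, hp, List.length_cons]⟩

theorem dist_root (v : τ.Vertex) : τ.graph.dist τ.root v = v.1.length := by
  obtain ⟨p, hp⟩ := exists_walk_length_eq v.1 v.2
  refine le_antisymm (hp ▸ SimpleGraph.dist_le p) ?_
  obtain ⟨q, hq⟩ := p.reachable.exists_walk_length_eq_dist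
  have := length_le_of_walk q
  rw [hq] at this
  simpa [root] using this

/-- Depth grows by at most one per step, so a walk as short as the depth of its end only descends
and its penultimate vertex is the parent. -/
theorem mem_support_iff_of_length_eq (w : τ.Vertex) (u : List ℕ) (hu : u ∈ τ.carrier)
    (p : τ.graph.Walk τ.root ⟨u, hu⟩) (hp : p.length = u.length) :
    w ∈ p.support ↔ w.1 <:+ u := by
  induction u with
  | nil =>
    cases p with
    | nil => simp [Subtype.ext_iff, root]
    | cons h p => simp at hp
  | cons j u ih =>
    have hne : ¬ p.Nil := fun h => by
      simp [SimpleGraph.Walk.length_eq_zero_iff.2 h] at hp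
    obtain ⟨x, q, h, rfl⟩ : ∃ (x : τ.Vertex) (q : τ.graph.Walk τ.root x)
        (h : τ.graph.Adj x ⟨j :: u, hu⟩), p = q.concat h :=
      ⟨_, p.dropLast, p.adj_penultimate hne, (p.concat_dropLast _).symm⟩
    rw [SimpleGraph.Walk.length_concat, List.length_cons, Nat.add_right_cancel_iff] at hp
    have hx := length_le_of_walk q
    have hxu : x = ⟨u, τ.parent_mem j u hu⟩ := by
      rcases h with ⟨i, h⟩ | ⟨i, h⟩
      · exact Subtype.ext (List.cons.inj h).2.symm
      -- A child of the endpoint is too deep for `q` to reach.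
      · have hroot : τ.root.1.length = 0 := rfl
        rw [h, List.length_cons, List.length_cons] at hx
        omega
    subst hxu
    rw [SimpleGraph.Walk.support_concat, List.suffix_cons_iff, ← ih _ q hp]
    simp [Subtype.ext_iff, or_comm]

/-- The geodesic from the root to `v` consists of the ancestors of `v`, including `v`. -/
theorem mem_treePath_root {v w : τ.Vertex} : w ∈ τ.treePath τ.root v ↔ w.1 <:+ v.1 := by
  constructor
  · rintro ⟨p, hp, hw⟩
    exact (mem_support_iff_of_length_eq w v.1 v.2 p (hp.trans (dist_root v))).1 hw
  · intro hw
    obtain ⟨p, hp⟩ := exists_walk_length_eq v.1 v.2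
    exact ⟨p, hp.trans (dist_root v).symm, (mem_support_iff_of_length_eq w v.1 v.2 p hp).2 hw⟩

/-! ### The contour and the descendants of a vertex -/

theorem suffix_iff_of_adj {w x y : τ.Vertex} (h : τ.graph.Adj x y) (hx : x ≠ w) (hy : y ≠ w) :
    w.1 <:+ x.1 ↔ w.1 <:+ y.1 := by
  have hx' : w.1 ≠ x.1 := fun e => hx (Subtype.ext e.symm)
  have hy' : w.1 ≠ y.1 := fun e => hy (Subtype.ext e.symm)
  rcases h with ⟨j, h⟩ | ⟨j, h⟩
  · rw [h] at hy' ⊢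
    simp [List.suffix_cons_iff, hy']
  · rw [h] at hx' ⊢
    simp [List.suffix_cons_iff, hx']

theorem Corner.next_vertex (c : τ.Corner) :
    c.next.vertex = c.vertex ∨ τ.graph.Adj c.vertex c.next.vertex := by
  obtain ⟨⟨u, hu⟩, i, hi⟩ := c
  unfold Corner.next
  split_ifs with h
  · exact Or.inr (Or.inl ⟨i, rfl⟩)
  · cases u with
    -- `Corner.next` is stationary at the last corner of the root.
    | nil => exact Or.inl rfl
    | cons j u => exact Or.inr (Or.inr ⟨j, rfl⟩)

theorem Corner.prev_vertex (c : τ.Corner) :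
    c.prev.vertex = c.vertex ∨ τ.graph.Adj c.vertex c.prev.vertex := by
  obtain ⟨⟨u, hu⟩, i, hi⟩ := c
  cases i with
  | succ i => exact Or.inr (Or.inl ⟨i, rfl⟩)
  | zero =>
    cases u with
    | nil => exact Or.inl rfl
    | cons j u => exact Or.inr (Or.inr ⟨j, rfl⟩)

theorem contour_vertex_step (τ : PlaneTree) (k : ℤ) :
    (τ.contour (k + 1)).vertex = (τ.contour k).vertex ∨
      τ.graph.Adj (τ.contour k).vertex (τ.contour (k + 1)).vertex := by
  rcases k with n | n
  · have h : τ.contour (Int.ofNat n + 1) = (τ.contour (Int.ofNat n)).next :=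
      Function.iterate_succ_apply' _ _ _
    rw [h]
    exact Corner.next_vertex _
  · have h : (τ.contour (Int.negSucc n)).vertex =
        (Corner.prev^[n] ⟨τ.root, τ.numChildren τ.root, le_refl _⟩).prev.vertex :=
      congrArg Corner.vertex (Function.iterate_succ_apply' _ _ _)
    -- Only vertices agree here: for `n = 0` the two sides are the two halves of the root corner.
    have h' : (τ.contour (Int.negSucc n + 1)).vertex =
        (Corner.prev^[n] ⟨τ.root, τ.numChildren τ.root, le_refl _⟩).vertex := by
      cases n with
      | zero => rfl
      | succ n => rfl
    rw [h, h']
    exact (Corner.prev_vertex _).imp Eq.symm SimpleGraph.Adj.symm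

/-- The contour visits `w` whenever it enters or leaves the set of descendants of `w`. -/
theorem exists_contour_vertex_eq {w : τ.Vertex} {i j : ℤ} (hij : i ≤ j)
    (h : ¬ (w.1 <:+ (τ.contour i).vertex.1 ↔ w.1 <:+ (τ.contour j).vertex.1)) :
    ∃ k, i ≤ k ∧ k ≤ j ∧ (τ.contour k).vertex = w := by
  by_contra! hne
  refine h ?_
  clear h
  induction j, hij using Int.leInduction with
  | base => rfl
  | succ j hij ih =>
    refine (ih fun k hik hkj => hne k hik (by omega)).trans ?_
    rcases τ.contour_vertex_step j with h | h
    · rw [h]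
    · exact suffix_iff_of_adj h (hne j hij (by omega)) (hne _ (by omega) le_rfl)

end PlaneTree

namespace LabeledTree

open PlaneTree

variable {θ : LabeledTree}

/-! ### Labels along arcs -/

theorem abs_label_sub_le_of_adj {u v : θ.Vertex} (h : θ.graph.Adj u v) :
    |θ.label u - θ.label v| ≤ 1 := by
  rcases h with h | h
  · exact θ.abs_label_sub_le u v h
  · rw [abs_sub_comm]
    exact θ.abs_label_sub_le v u h

theorem cornerLabel_le_succ (θ : LabeledTree) (k : ℤ) :
    θ.cornerLabel k ≤ θ.cornerLabel (k + 1) + 1 := by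
  unfold cornerLabel
  rcases θ.contour_vertex_step k with h | h
  · rw [h]
    omega
  · have := abs_le.1 (abs_label_sub_le_of_adj h)
    omega

/-- Discrete intermediate values: labels descend by at most one, so getting below the source would
first hit its label minus one, which happens only at `j`. -/
theorem IsSuccessor.cornerLabel_le {i j : ℤ} (h : θ.IsSuccessor i j) {k : ℤ} (hik : i ≤ k)
    (hkj : k < j) : θ.cornerLabel i ≤ θ.cornerLabel k := by
  induction k, hik using Int.leInduction with
  | base => rfl
  | succ k hik ih =>
    have hk := ih (by omega)
    have hstep := θ.cornerLabel_le_succ k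
    have hne : θ.cornerLabel (k + 1) ≠ θ.cornerLabel i - 1 := fun e => by
      have := h.2 ⟨show i < k + 1 by omega, e⟩
      omega
    omega

/-- An ancestor of just one end of an arc is the target of the arc or has at least the label of its
source. -/
theorem IsSuccessor.eq_or_le_label {i j : ℤ} (h : θ.IsSuccessor i j) {w : θ.Vertex}
    (hw : ¬ (w.1 <:+ (θ.contour i).vertex.1 ↔ w.1 <:+ (θ.contour j).vertex.1)) :
    w = (θ.contour j).vertex ∨ θ.cornerLabel i ≤ θ.label w := by
  obtain ⟨k, hik, hkj, rfl⟩ := exists_contour_vertex_eq h.1.1.le hw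
  rcases hkj.eq_or_lt with rfl | hkj
  · exact Or.inl rfl
  · exact Or.inr (h.cornerLabel_le hik hkj)

/-! ### Ancestor labels and the root component -/

/-- All ancestors of `v`, including `v`, have labels larger than `l`. -/
def AncestorsAbove (θ : LabeledTree) (l : ℤ) (v : θ.Vertex) : Prop :=
  ∀ w : θ.Vertex, w.1 <:+ v.1 → l < θ.label w

theorem AncestorsAbove.lt_label {l : ℤ} {v : θ.Vertex} (h : θ.AncestorsAbove l v) :
    l < θ.label v :=
  h v List.suffix_rfl

theorem AncestorsAbove.strict_ancestor_of_adj {l : ℤ} {u v w : θ.Vertex}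
    (hu : θ.AncestorsAbove l u) (h : θ.graph.Adj u v) (hw : w.1 <:+ v.1) (hne : w ≠ v) :
    l < θ.label w := by
  refine hu w ?_
  rcases h with ⟨j, h⟩ | ⟨j, h⟩
  · rw [h, List.suffix_cons_iff, ← h] at hw
    exact hw.resolve_left fun e => hne (Subtype.ext e)
  · rw [h]
    exact hw.trans (List.suffix_cons j v.1)

/-- If `u` and all its ancestors have labels larger than `l`, then a neighbor `v` of `u` in `Q̂` has
label at least `l` and all its strict ancestors have labels larger than `l`. -/
theorem AncestorsAbove.of_augGraph_adj {l : ℤ} {u v : θ.Vertex} (hu : θ.AncestorsAbove l u)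
    (h : θ.augGraph.Adj u v) :
    l ≤ θ.label v ∧ ∀ w : θ.Vertex, w.1 <:+ v.1 → w ≠ v → l < θ.label w := by
  have hlu := hu.lt_label
  rcases h with h | h
  · obtain ⟨-, ⟨i, j, hs, rfl, rfl⟩ | ⟨i, j, hs, rfl, rfl⟩⟩ :=
      (SimpleGraph.fromRel_adj _ _ _).1 h
    · have hlab : θ.label (θ.contour j).vertex = θ.label (θ.contour i).vertex - 1 := hs.1.2
      refine ⟨by omega, fun w hw hne => ?_⟩
      by_cases hwu : w.1 <:+ (θ.contour i).vertex.1
      · exact hu w hwu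
      -- Here `u` is the source, and `w` is not the target `v`.
      · exact hlu.trans_le ((hs.eq_or_le_label fun e => hwu (e.2 hw)).resolve_left hne)
    · have hlab : θ.label (θ.contour j).vertex = θ.label (θ.contour i).vertex - 1 := hs.1.2
      refine ⟨by omega, fun w hw _ => ?_⟩
      by_cases hwu : w.1 <:+ (θ.contour j).vertex.1
      · exact hu w hwu
      -- Now `u` is the target, so the source label exceeds that of `u`; both alternatives lie above
      -- `l`.
      · rcases hs.eq_or_le_label fun e => hwu (e.1 hw) with rfl | hle
        · exact hlu
        · have hle : θ.label (θ.contour i).vertex ≤ θ.label w := hle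
          omega
  · have := abs_le.1 (abs_label_sub_le_of_adj h)
    exact ⟨by omega, fun w hw hne => hu.strict_ancestor_of_adj h hw hne⟩

theorem AncestorsAbove.of_augGraph_adj_of_lt {l : ℤ} {u v : θ.Vertex} (hu : θ.AncestorsAbove l u)
    (h : θ.augGraph.Adj u v) (hv : l < θ.label v) : θ.AncestorsAbove l v := by
  intro w hw
  by_cases hwv : w = v
  · rwa [hwv]
  · exact (hu.of_augGraph_adj h).2 w hw hwv

theorem AncestorsAbove.of_walk {l : ℤ} {u v : ↥(θ.horoball l)ᶜ}
    (p : (θ.augGraph.induce (θ.horoball l)ᶜ).Walk u v) (hu : θ.AncestorsAbove l u.1) :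
    θ.AncestorsAbove l v.1 := by
  induction p with
  | nil => exact hu
  | @cons u x v h p ih => exact ih (hu.of_augGraph_adj_of_lt h (not_le.1 x.2))

theorem AncestorsAbove.mem_rootComponent {l : ℤ} (u : List ℕ) (hu : u ∈ θ.carrier)
    (h : θ.AncestorsAbove l ⟨u, hu⟩) : (⟨u, hu⟩ : θ.Vertex) ∈ θ.rootComponent l := by
  induction u with
  | nil => exact ⟨not_le.2 h.lt_label, not_le.2 h.lt_label, SimpleGraph.Reachable.refl _⟩
  | cons j u ih =>
    obtain ⟨h₀, hp, hr⟩ := ih (θ.parent_mem j u hu)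
      fun w hw => h w (hw.trans (List.suffix_cons j u))
    have hadj : θ.augGraph.Adj ⟨u, θ.parent_mem j u hu⟩ ⟨j :: u, hu⟩ := Or.inr (Or.inl ⟨j, rfl⟩)
    have hv : (⟨j :: u, hu⟩ : θ.Vertex) ∈ (θ.horoball l)ᶜ := not_le.2 h.lt_label
    have hadj' : (θ.augGraph.induce (θ.horoball l)ᶜ).Adj ⟨_, hp⟩ ⟨_, hv⟩ := hadj
    exact ⟨h₀, hv, hr.trans hadj'.reachable⟩

theorem mem_rootComponent_iff {l : ℤ} {v : θ.Vertex} :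
    v ∈ θ.rootComponent l ↔ θ.AncestorsAbove l v := by
  refine ⟨?_, fun h => h.mem_rootComponent v.1 v.2⟩
  rintro ⟨h₀, hv, ⟨p⟩⟩
  refine AncestorsAbove.of_walk p fun w hw => ?_
  have hw : w = θ.root := Subtype.ext (List.suffix_nil.1 hw)
  rw [hw]
  exact not_le.1 h₀

theorem mem_rootComponentBoundary_iff {l : ℤ} (hl : l < θ.label θ.root) {v : θ.Vertex} :
    v ∈ θ.rootComponentBoundary l ↔
      θ.label v = l ∧ ∀ w : θ.Vertex, w.1 <:+ v.1 → w ≠ v → l < θ.label w := by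
  constructor
  · rintro ⟨hv, u, hu, hadj⟩
    have h := (mem_rootComponent_iff.1 hu).of_augGraph_adj hadj
    exact ⟨le_antisymm hv h.1, h.2⟩
  · rintro ⟨hv, h⟩
    refine ⟨hv.le, ?_⟩
    obtain ⟨_ | ⟨j, u⟩, hu⟩ := v
    -- The root lies above `l`; any other candidate has a parent, which serves as the neighbor in
    -- the component.
    · exact absurd hv hl.ne'
    · refine ⟨⟨u, θ.parent_mem j u hu⟩, mem_rootComponent_iff.2 fun w hw => ?_,
        Or.inr (Or.inl ⟨j, rfl⟩)⟩
      refine h w (hw.trans (List.suffix_cons j u)) fun e => ?_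
      have hlen := hw.length_le
      simp only [e, List.length_cons] at hlen
      omega

theorem InS.mem_rootComponent_and_boundary_iff (h : θ.InS) (r : ℤ) (hr : 0 < r) (v : θ.Vertex) :
    (v ∈ θ.rootComponent (-r) ↔ ∀ w ∈ θ.treePath θ.root v, θ.label w > -r) ∧
      (v ∈ θ.rootComponentBoundary (-r) ↔
        θ.label v = -r ∧ ∀ w ∈ θ.treePath θ.root v \ {v}, θ.label w > -r) := by
  have hl : -r < θ.label θ.root := by
    rw [h.label_root]
    omega
  constructor
  · simp only [mem_rootComponent_iff, AncestorsAbove, mem_treePath_root, gt_iff_lt]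
  · simp only [mem_rootComponentBoundary_iff hl, Set.mem_sdiff, Set.mem_singleton_iff,
      mem_treePath_root, gt_iff_lt, and_imp]

end LabeledTree

theorem proposition4 :
    (∀ θ : LabeledTree, θ.InS → ∀ r : ℤ, 0 < r → ∀ v : θ.Vertex,
      (v ∈ θ.rootComponent (-r) ↔ ∀ w ∈ θ.treePath θ.root v, θ.label w > -r) ∧
      (v ∈ θ.rootComponentBoundary (-r) ↔
        θ.label v = -r ∧ ∀ w ∈ θ.treePath θ.root v \ {v}, θ.label w > -r)) ∧
    (∀ {Ω : Type*} [MeasurableSpace Ω] (P : Measure Ω) [IsProbabilityMeasure P]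
      (θ : Ω → LabeledTree), LabeledTree.IsUniformInfiniteTree P θ →
      ∀ᵐ ω ∂P, ∀ r : ℤ, 0 < r → ∀ v : (θ ω).Vertex,
        (v ∈ (θ ω).rootComponent (-r) ↔
          ∀ w ∈ (θ ω).treePath (θ ω).root v, (θ ω).label w > -r) ∧
        (v ∈ (θ ω).rootComponentBoundary (-r) ↔
          (θ ω).label v = -r ∧
            ∀ w ∈ (θ ω).treePath (θ ω).root v \ {v}, (θ ω).label w > -r)) := by
  refine ⟨fun θ h => h.mem_rootComponent_and_boundary_iff, fun P _ θ hθ => ?_⟩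
  -- The almost sure statement is the deterministic one on the event that the tree lies in `𝒮`.
  filter_upwards [hθ.inS] with ω h
  exact h.mem_rootComponent_and_boundary_iff
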